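/- Let $\mathcal C$ be a variety of universal algebras (all algebras of a fixed finitary signature satisfying a fixed set of identities, with homomorphisms as morphisms; the empty algebra is allowed when there are no constant symbols). Let $0$ be its initial object, so that the underlying set of $0$ is the set of constants (closed terms modulo the identities of $\mathcal C$), and for an object $X$ let $!_X\colon 0\to X$ be the unique morphism. For an object $B$, let $B/\mathcal C$ be the category of morphisms of $\mathcal C$ with domain $B$. A diagonalising term of $\mathcal C$ is a $(k+2)$-ary term $t$, for some $k\ge 1$, for which there are constants $e_1,\dots,e_k,e_1',\dots,e_k'\in 0$ such that the identities $$t(x,y,e_1,\dots,e_k)=x,\qquad t(x,y,e_1',\dots,e_k')=y$$ hold in $\mathcal C$. For a morphism $i\colon B\to A$, let $\mathbf{RRel}_{A,i}$ be the full subcategory of $B/\mathcal C$ on the objects $r\colon B\to R$ for which there is a monomorphism $d\colon R\to A\times A$ with $d\circ r=\Delta_A\circ i$, where $\Delta_A\colon A\to A\times A$ is the diagonal. Put $\mathbf{Rel}_X=\mathbf{RRel}_{X,\,!_X}$, a full subcategory of $0/\mathcal C$, and $\mathbf{SPRRel}_{X,Y}=\mathbf{RRel}_{X\times Y,\;!_X\times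 !_Y}$, a full subcategory of $(0\times 0)/\mathcal C$ whose objects are called the subproduct reflexive relations on $X\times Y$. Then $\mathcal C$ has a diagonalising term if and only if, for all objects $X,Y$ of $\mathcal C$, the canonical functor $\times\colon 0/\mathcal C\times 0/\mathcal C\to(0\times 0)/\mathcal C$, $(f,g)\mapsto f\times g$, restricts to a functor $\times'\colon\mathbf{Rel}_X\times\mathbf{Rel}_Y\to\mathbf{SPRRel}_{X,Y}$, and this functor $\times'$ is an equivalence of categories. -/

import Mathlib

open CategoryTheory CategoryTheory.Limits
open scoped FirstOrder

universe u v w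

/-! ### Relations and the product functor in a category with binary products -/

section Categorical

variable {C : Type u} [Category.{v} C]

/-- The canonical functor `X/C × Y/C ⥤ (X × Y)/C`, sending a pair of morphisms `(f, g)` to their
product `f × g`. -/
noncomputable def underProd [HasBinaryProducts C] (X Y : C) :
    Under X × Under Y ⥤ Under (X ⨯ Y) where
  obj P := Under.mk (prod.map P.1.hom P.2.hom)
  map φ := Under.homMk (prod.map φ.1.right φ.2.right) (by simp)

/-- For a morphism `i : B ⟶ A`, the objects `r : B ⟶ R` of `B/C` such that `R` is (the domain of)
a relation on `A` that is reflexive on `B` through `r`: there is a monomorphism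
`d : R ⟶ A × A` with `d ∘ r = Δ_A ∘ i`. -/
def IsReflexiveRelOn [HasBinaryProducts C] {A B : C} (i : B ⟶ A) : ObjectProperty (Under B) :=
  fun r => ∃ d : r.right ⟶ A ⨯ A, Mono d ∧ r.hom ≫ d = i ≫ diag A

/-- The objects of `Rel_X`, as objects of `0/C`: relations on `X` reflexive on `0`
(which is no condition on a relation). -/
noncomputable def IsRel [HasBinaryProducts C] [HasInitial C] (X : C) :
    ObjectProperty (Under (⊥_ C)) :=
  IsReflexiveRelOn (initial.to X)

/-- The objects of `SPRRel_{X,Y}`, as objects of `(0 × 0)/C`: the subproduct reflexive relations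
on `X × Y`, that is, the relations on `X × Y` reflexive on `0 × 0` along `!_X × !_Y`. -/
noncomputable def IsSPRRel [HasBinaryProducts C] [HasInitial C] (X Y : C) :
    ObjectProperty (Under ((⊥_ C) ⨯ (⊥_ C))) :=
  IsReflexiveRelOn (prod.map (initial.to X) (initial.to Y))

/-- The category `Rel_X` of relations on `X`, a full subcategory of `0/C`. -/
abbrev RelCat [HasBinaryProducts C] [HasInitial C] (X : C) : Type _ :=
  (IsRel X).FullSubcategory

/-- The category `SPRRel_{X,Y}` of subproduct reflexive relations on `X × Y`, a full subcategory
of `(0 × 0)/C`. -/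
abbrev SPRRelCat [HasBinaryProducts C] [HasInitial C] (X Y : C) : Type _ :=
  (IsSPRRel X Y).FullSubcategory

/-- The canonical functor `0/C × 0/C ⥤ (0 × 0)/C` carries `Rel_X × Rel_Y` into `SPRRel_{X,Y}`. -/
def ProductRestricts [HasBinaryProducts C] [HasInitial C] (X Y : C) : Prop :=
  ∀ P : RelCat X × RelCat Y, IsSPRRel X Y
    ((underProd (⊥_ C) (⊥_ C)).obj (P.1.obj, P.2.obj))

/-- The restriction `Rel_X × Rel_Y ⥤ SPRRel_{X,Y}` of the canonical functor. -/
noncomputable def restrictedProduct [HasBinaryProducts C] [HasInitial C] {X Y : C}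
    (h : ProductRestricts X Y) : RelCat X × RelCat Y ⥤ SPRRelCat X Y :=
  (IsSPRRel X Y).lift
    ((IsRel X).ι.prod (IsRel Y).ι ⋙ underProd (⊥_ C) (⊥_ C)) h

end Categorical

/-! ### Varieties of universal algebras -/

/-- An algebra of the variety with signature `L` and set of identities `E`, an identity being a
pair of terms in countably many variables. (The carrier may be empty.) -/
structure VarietyAlg (L : FirstOrder.Language.{u, v}) (E : Set (L.Term ℕ × L.Term ℕ)) where
  carrier : Type w
  [str : L.Structure carrier]
  sat : ∀ p ∈ E, ∀ x : ℕ → carrier, p.1.realize x = p.2.realize x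

attribute [instance] VarietyAlg.str

namespace VarietyAlg

variable {L : FirstOrder.Language.{u, v}} {E : Set (L.Term ℕ × L.Term ℕ)}

/-- The category of algebras of a variety and homomorphisms. -/
instance : Category (VarietyAlg.{u, v, w} L E) where
  Hom A B := A.carrier →[L] B.carrier
  id A := FirstOrder.Language.Hom.id L A.carrier
  comp f g := FirstOrder.Language.Hom.comp g f

/-- The variety has a diagonalising term: a `(k + 2)`-ary term `t`, `k ≥ 1`, and constants
(closed terms) `e₁, …, e_k, e₁', …, e_k'` such that the identities `t(x, y, e₁, …, e_k) = x` and
`t(x, y, e₁', …, e_k') = y` hold in the variety. -/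
def HasDiagonalisingTerm (L : FirstOrder.Language.{u, v}) (E : Set (L.Term ℕ × L.Term ℕ)) : Prop :=
  ∃ k : ℕ, 1 ≤ k ∧ ∃ (t : L.Term (Fin 2 ⊕ Fin k)) (e e' : Fin k → L.Term Empty),
    ∀ (A : VarietyAlg.{u, v, w} L E) (x y : A.carrier),
      t.realize (Sum.elim ![x, y] fun i => (e i).realize Empty.elim) = x ∧
      t.realize (Sum.elim ![x, y] fun i => (e' i).realize Empty.elim) = y

/-! #### Binary products -/

instance prodStructure (A B : Type w) [L.Structure A] [L.Structure B] :
    L.Structure (A × B) where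
  funMap f x := (FirstOrder.Language.Structure.funMap f fun i => (x i).1,
    FirstOrder.Language.Structure.funMap f fun i => (x i).2)
  RelMap r x := FirstOrder.Language.Structure.RelMap r (fun i => (x i).1) ∧
    FirstOrder.Language.Structure.RelMap r fun i => (x i).2

def fstHom (A B : Type w) [L.Structure A] [L.Structure B] : A × B →[L] A where
  toFun := Prod.fst
  map_fun' _ _ := rfl
  map_rel' _ _ h := h.1

def sndHom (A B : Type w) [L.Structure A] [L.Structure B] : A × B →[L] B where
  toFun := Prod.snd
  map_fun' _ _ := rfl
  map_rel' _ _ h := h.2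

/-- The product of two algebras, with componentwise operations. -/
def prodAlg (A B : VarietyAlg.{u, v, w} L E) : VarietyAlg.{u, v, w} L E where
  carrier := A.carrier × B.carrier
  sat p hp x := by
    refine Prod.ext ?_ ?_
    · have h := A.sat p hp (fun i => (x i).1)
      have key : ∀ t : L.Term ℕ, (t.realize x).1 = t.realize (fun i => (x i).1) := fun t =>
        (FirstOrder.Language.HomClass.realize_term (fstHom (L := L) A.carrier B.carrier)
          (t := t) (v := x)).symm
      rw [key, key, h]
    · have h := B.sat p hp (fun i => (x i).2)
      have key : ∀ t : L.Term ℕ, (t.realize x).2 = t.realize (fun i => (x i).2) := fun t =>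
        (FirstOrder.Language.HomClass.realize_term (sndHom (L := L) A.carrier B.carrier)
          (t := t) (v := x)).symm
      rw [key, key, h]

def prodFan (A B : VarietyAlg.{u, v, w} L E) : BinaryFan A B :=
  BinaryFan.mk (P := prodAlg A B) (fstHom A.carrier B.carrier) (sndHom A.carrier B.carrier)

def pairHom {A B D : VarietyAlg.{u, v, w} L E} (f : D ⟶ A) (g : D ⟶ B) : D ⟶ prodAlg A B :=
  { toFun := fun z => (FirstOrder.Language.Hom.toFun f z, FirstOrder.Language.Hom.toFun g z)
    map_fun' := fun {_} φ z =>
      Prod.ext (FirstOrder.Language.Hom.map_fun' f φ z) (FirstOrder.Language.Hom.map_fun' g φ z)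
    map_rel' := fun {_} r z h =>
      ⟨FirstOrder.Language.Hom.map_rel' f r z h, FirstOrder.Language.Hom.map_rel' g r z h⟩ }

def prodFanIsLimit (A B : VarietyAlg.{u, v, w} L E) : IsLimit (prodFan A B) :=
  BinaryFan.isLimitMk (fun s => pairHom s.fst s.snd) (fun _ => rfl) (fun _ => rfl)
    (fun s m h₁ h₂ => by
      apply FirstOrder.Language.Hom.ext
      intro z
      refine Prod.ext ?_ ?_
      · exact congrArg (fun q : s.pt ⟶ A => FirstOrder.Language.Hom.toFun q z) h₁
      · exact congrArg (fun q : s.pt ⟶ B => FirstOrder.Language.Hom.toFun q z) h₂)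

instance : HasBinaryProducts (VarietyAlg.{u, v, w} L E) :=
  haveI : ∀ {A B : VarietyAlg.{u, v, w} L E}, HasLimit (pair A B) :=
    fun {A B} => ⟨⟨⟨prodFan A B, prodFanIsLimit A B⟩⟩⟩
  hasBinaryProducts_of_hasLimit_pair _

/-! #### The initial algebra: closed terms modulo the identities of the variety -/

variable (L E) in
/-- Two closed terms are identified when they agree in all algebras of the variety. -/
def closedSetoid : Setoid (L.Term PEmpty.{w + 1}) where
  r s t := ∀ A : VarietyAlg.{u, v, max u w} L E,
    s.realize (PEmpty.elim : PEmpty → A.carrier) = t.realize PEmpty.elim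
  iseqv := ⟨fun _ _ => rfl, fun h A => (h A).symm, fun h h' A => (h A).trans (h' A)⟩

variable (L E) in
abbrev ClosedTerms : Type (max u w) := Quotient (closedSetoid.{u, v, w} L E)

noncomputable instance closedStructure [L.IsAlgebraic] :
    L.Structure (ClosedTerms.{u, v, w} L E) where
  funMap f x := ⟦FirstOrder.Language.Term.func f fun i => (x i).out⟧
  RelMap r _ := isEmptyElim r

/-- The value of a class of closed terms in an algebra. -/
def evalClosed (A : VarietyAlg.{u, v, max u w} L E) (q : ClosedTerms.{u, v, w} L E) :
    A.carrier :=
  Quotient.lift (s := closedSetoid.{u, v, w} L E)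
    (fun t => t.realize (PEmpty.elim : PEmpty → A.carrier)) (fun _ _ h => h A) q

theorem evalClosed_out (A : VarietyAlg.{u, v, max u w} L E) (q : ClosedTerms.{u, v, w} L E) :
    q.out.realize (PEmpty.elim : PEmpty → A.carrier) = evalClosed A q := by
  conv_rhs => rw [← Quotient.out_eq q]
  rfl

theorem realize_closed [L.IsAlgebraic] {α : Type*} (t : L.Term α)
    (x : α → ClosedTerms.{u, v, w} L E) :
    t.realize x = (⟦t.subst fun i => (x i).out⟧ : ClosedTerms.{u, v, w} L E) := by
  induction t with
  | var i => exact (Quotient.out_eq _).symm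
  | func f ts ih =>
    apply Quotient.sound
    intro A
    simp only [FirstOrder.Language.Term.realize_func, ih]
    congr 1
    funext i
    exact evalClosed_out A _

variable (L E) in
/-- The free algebra on the empty set. -/
noncomputable def initialAlg [L.IsAlgebraic] : VarietyAlg.{u, v, max u w} L E where
  carrier := ClosedTerms.{u, v, w} L E
  sat p hp x := by
    rw [realize_closed, realize_closed]
    apply Quotient.sound
    intro A
    rw [FirstOrder.Language.Term.realize_subst, FirstOrder.Language.Term.realize_subst]
    exact A.sat p hp _

def evalHom [L.IsAlgebraic] (A : VarietyAlg.{u, v, max u w} L E) :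
    initialAlg.{u, v, w} L E ⟶ A :=
  { toFun := evalClosed A
    map_fun' := fun {_} f x => by
      change FirstOrder.Language.Structure.funMap f (fun i => (x i).out.realize PEmpty.elim) = _
      congr 1
      funext i
      exact evalClosed_out A _
    map_rel' := fun {_} r _ _ => isEmptyElim r }

theorem hom_initialAlg [L.IsAlgebraic] {A : VarietyAlg.{u, v, max u w} L E}
    (f : initialAlg.{u, v, w} L E ⟶ A) : f = evalHom A := by
  apply FirstOrder.Language.Hom.ext
  intro q
  induction q using Quotient.inductionOn with
  | h t =>
    have h₁ : t.realize (PEmpty.elim : PEmpty → ClosedTerms.{u, v, w} L E) = ⟦t⟧ := by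
      rw [realize_closed]
      apply Quotient.sound
      intro B
      rw [FirstOrder.Language.Term.realize_subst]
      congr 1
      funext i
      exact i.elim
    have h₂ := FirstOrder.Language.HomClass.realize_term (L := L) (M := ClosedTerms.{u, v, w} L E)
      (N := A.carrier) (F := ClosedTerms.{u, v, w} L E →[L] A.carrier) f (t := t)
      (v := PEmpty.elim)
    rw [h₁] at h₂
    refine h₂.symm.trans ?_
    change _ = t.realize PEmpty.elim
    congr 1
    funext i
    exact i.elim

noncomputable def initialAlgIsInitial [L.IsAlgebraic] :
    IsInitial (initialAlg.{u, v, w} L E) :=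
  IsInitial.ofUniqueHom evalHom fun _ f => hom_initialAlg f

instance [L.IsAlgebraic] : HasInitial (VarietyAlg.{u, v, max u w} L E) :=
  (initialAlgIsInitial.{u, v, w} (L := L) (E := E)).hasInitial

end VarietyAlg

namespace VarietyAlg

variable {L : FirstOrder.Language.{u, v}} {E : Set (L.Term ℕ × L.Term ℕ)}

/-! ### Homomorphisms as functions -/

/-! A diagonalising term glues. In an algebra `W` under `0 × 0`, the element `t(p, q, r(e₁, e₁'),
…)` agrees with `p` under every map inducing the first projection of `0 × 0`, and with `q` under
every map inducing the second (`exists_glue`). Gluing forces the components of a morphism between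
products to depend on one coordinate each (`full`), and makes a subproduct reflexive relation the
product of its two images (`essSurj`).

Conversely, let `F` be free on `x, y`, and let `S ⊆ F × F` be generated by `(x, x)`, `(y, y)` and
the image of `0 × 0`. Essential surjectivity makes `S` a product and fullness makes its inclusion a
product of maps, so `S` contains `(x, y)` (`pair_mem_closure_of_isEquivalence`). A term expressing
`(x, y)` through the generators, read in each coordinate, is diagonalising. At least one constant
exists by fullness (`nonempty_initial_of_full`). -/

/-- The function underlying a morphism of algebras. -/
def app {A B : VarietyAlg.{u, v, w} L E} (f : A ⟶ B) (a : A.carrier) : B.carrier :=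
  FirstOrder.Language.Hom.toFun f a

theorem hom_ext_app {A B : VarietyAlg.{u, v, w} L E} {f g : A ⟶ B}
    (h : ∀ a, app f a = app g a) : f = g :=
  FirstOrder.Language.Hom.ext h

@[simp]
theorem app_comp {A B D : VarietyAlg.{u, v, w} L E} (f : A ⟶ B) (g : B ⟶ D) (a : A.carrier) :
    app (f ≫ g) a = app g (app f a) := rfl

theorem app_realize {A B : VarietyAlg.{u, v, w} L E} (f : A ⟶ B) {α : Type*} (t : L.Term α)
    (x : α → A.carrier) : app f (t.realize x) = t.realize fun i => app f (x i) :=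
  (FirstOrder.Language.HomClass.realize_term (L := L) (F := A.carrier →[L] B.carrier) f
    (t := t) (v := x)).symm

theorem app_funMap {A B : VarietyAlg.{u, v, w} L E} (f : A ⟶ B) {n : ℕ} (φ : L.Functions n)
    (x : Fin n → A.carrier) :
    app f (FirstOrder.Language.Structure.funMap φ x) =
      FirstOrder.Language.Structure.funMap φ fun i => app f (x i) :=
  FirstOrder.Language.Hom.map_fun' f φ x

theorem app_congr {A B : VarietyAlg.{u, v, w} L E} {f g : A ⟶ B} (h : f = g) (a : A.carrier) :
    app f a = app g a := by rw [h]

/-- Build a morphism from a function preserving the operations. -/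
def homMk [L.IsAlgebraic] {A B : VarietyAlg.{u, v, w} L E} (f : A.carrier → B.carrier)
    (hf : ∀ {n : ℕ} (φ : L.Functions n) (x : Fin n → A.carrier),
      f (FirstOrder.Language.Structure.funMap φ x) =
        FirstOrder.Language.Structure.funMap φ fun i => f (x i)) : A ⟶ B :=
  { toFun := f
    map_fun' := hf
    map_rel' := fun {_} r _ _ => isEmptyElim r }

theorem isIso_of_bijective [L.IsAlgebraic] {A B : VarietyAlg.{u, v, w} L E} (f : A ⟶ B)
    (hf : Function.Bijective (app f)) : IsIso f := by
  let e := Equiv.ofBijective _ hf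
  have he : ∀ b, app f (e.symm b) = b := e.apply_symm_apply
  refine ⟨homMk e.symm fun φ x => ?_, hom_ext_app e.symm_apply_apply, hom_ext_app he⟩
  apply hf.1
  simp [app_funMap, he]

/-! ### Elements of binary products -/

/-- The comparison morphism from the algebra of pairs to the binary product. -/
noncomputable def ofPairs (A B : VarietyAlg.{u, v, w} L E) : prodAlg A B ⟶ A ⨯ B :=
  (prodFanIsLimit A B).conePointUniqueUpToIso (limit.isLimit (pair A B)) |>.hom

theorem ofPairs_fst (A B : VarietyAlg.{u, v, w} L E) :
    ofPairs A B ≫ prod.fst = (fstHom A.carrier B.carrier : prodAlg A B ⟶ A) :=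
  (prodFanIsLimit A B).conePointUniqueUpToIso_hom_comp (limit.isLimit (pair A B))
    ⟨WalkingPair.left⟩

theorem ofPairs_snd (A B : VarietyAlg.{u, v, w} L E) :
    ofPairs A B ≫ prod.snd = (sndHom A.carrier B.carrier : prodAlg A B ⟶ B) :=
  (prodFanIsLimit A B).conePointUniqueUpToIso_hom_comp (limit.isLimit (pair A B))
    ⟨WalkingPair.right⟩

theorem prod_ext_app {A B : VarietyAlg.{u, v, w} L E} {p q : (A ⨯ B).carrier}
    (h₁ : app (prod.fst : A ⨯ B ⟶ A) p = app (prod.fst : A ⨯ B ⟶ A) q)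
    (h₂ : app (prod.snd : A ⨯ B ⟶ B) p = app (prod.snd : A ⨯ B ⟶ B) q) : p = q := by
  let i : A ⨯ B ⟶ prodAlg A B := pairHom prod.fst prod.snd
  have hij : i ≫ ofPairs A B = 𝟙 _ := by
    apply Limits.prod.hom_ext
    · rw [Category.assoc, ofPairs_fst, Category.id_comp]
      rfl
    · rw [Category.assoc, ofPairs_snd, Category.id_comp]
      rfl
  have hi : app i p = app i q := Prod.ext h₁ h₂
  have := congrArg (app (ofPairs A B)) hi
  rwa [← app_comp, ← app_comp, hij] at this

theorem exists_pair {A B : VarietyAlg.{u, v, w} L E} (a : A.carrier) (b : B.carrier) :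
    ∃ p : (A ⨯ B).carrier,
      app (prod.fst : A ⨯ B ⟶ A) p = a ∧ app (prod.snd : A ⨯ B ⟶ B) p = b :=
  ⟨app (ofPairs A B) (a, b), app_congr (ofPairs_fst A B) _, app_congr (ofPairs_snd A B) _⟩

/-- The element of a binary product with the given coordinates. -/
noncomputable def mkPair {A B : VarietyAlg.{u, v, w} L E} (a : A.carrier) (b : B.carrier) :
    (A ⨯ B).carrier := (exists_pair a b).choose

theorem fst_mkPair {A B : VarietyAlg.{u, v, w} L E} (a : A.carrier) (b : B.carrier) :
    app (prod.fst : A ⨯ B ⟶ A) (mkPair a b) = a := (exists_pair a b).choose_spec.1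

theorem snd_mkPair {A B : VarietyAlg.{u, v, w} L E} (a : A.carrier) (b : B.carrier) :
    app (prod.snd : A ⨯ B ⟶ B) (mkPair a b) = b := (exists_pair a b).choose_spec.2

theorem app_prodMap_fst {A B A' B' : VarietyAlg.{u, v, w} L E} (f : A ⟶ A') (g : B ⟶ B')
    (p : (A ⨯ B).carrier) :
    app (prod.fst : A' ⨯ B' ⟶ A') (app (prod.map f g) p) = app f (app prod.fst p) := by
  rw [← app_comp, prod.map_fst, app_comp]

theorem app_prodMap_snd {A B A' B' : VarietyAlg.{u, v, w} L E} (f : A ⟶ A') (g : B ⟶ B')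
    (p : (A ⨯ B).carrier) :
    app (prod.snd : A' ⨯ B' ⟶ B') (app (prod.map f g) p) = app g (app prod.snd p) := by
  rw [← app_comp, prod.map_snd, app_comp]

theorem app_lift_fst {A B D : VarietyAlg.{u, v, w} L E} (f : D ⟶ A) (g : D ⟶ B)
    (d : D.carrier) : app (prod.fst : A ⨯ B ⟶ A) (app (prod.lift f g) d) = app f d := by
  rw [← app_comp, prod.lift_fst]

theorem app_lift_snd {A B D : VarietyAlg.{u, v, w} L E} (f : D ⟶ A) (g : D ⟶ B)
    (d : D.carrier) : app (prod.snd : A ⨯ B ⟶ B) (app (prod.lift f g) d) = app g d := by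
  rw [← app_comp, prod.lift_snd]

/-! ### Subalgebras -/

/-- A substructure of an algebra, as an algebra of the variety. -/
def subAlg {A : VarietyAlg.{u, v, w} L E} (S : L.Substructure A.carrier) :
    VarietyAlg.{u, v, w} L E where
  carrier := S
  sat p hp x := Subtype.ext <| by
    have key : ∀ t : L.Term ℕ, ((t.realize x : S) : A.carrier) =
        t.realize fun i => (x i : A.carrier) := fun t =>
      (FirstOrder.Language.HomClass.realize_term S.subtype (t := t) (v := x)).symm
    rw [key, key, A.sat p hp]

/-- The inclusion of a subalgebra. -/
def subIncl {A : VarietyAlg.{u, v, w} L E} (S : L.Substructure A.carrier) : subAlg S ⟶ A :=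
  S.subtype.toHom

/-- Corestriction of a morphism to a subalgebra. -/
def subLift {A B : VarietyAlg.{u, v, w} L E} (S : L.Substructure A.carrier) (f : B ⟶ A)
    (hf : ∀ b, app f b ∈ S) : B ⟶ subAlg S :=
  FirstOrder.Language.Hom.codRestrict S f hf

theorem subIncl_injective {A : VarietyAlg.{u, v, w} L E} (S : L.Substructure A.carrier) :
    Function.Injective (app (subIncl S)) := Subtype.val_injective

theorem mono_of_injective {A B : VarietyAlg.{u, v, w} L E} (f : A ⟶ B)
    (hf : Function.Injective (app f)) : Mono f :=
  ⟨fun _ _ h => hom_ext_app fun a => hf (app_congr h a)⟩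

instance {A : VarietyAlg.{u, v, w} L E} (S : L.Substructure A.carrier) : Mono (subIncl S) :=
  mono_of_injective _ (subIncl_injective S)

/-! ### Free algebras -/

variable (L E) in
/-- Two terms are identified when they agree in all algebras of the variety. -/
def termSetoid (α : Type w) : Setoid (L.Term α) where
  r s t := ∀ (A : VarietyAlg.{u, v, max u w} L E) (x : α → A.carrier), s.realize x = t.realize x
  iseqv := ⟨fun _ _ _ => rfl, fun h A x => (h A x).symm, fun h h' A x => (h A x).trans (h' A x)⟩

variable (L E) in
/-- Terms in the variables `α` modulo the identities of the variety. -/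
abbrev FreeTerms (α : Type w) : Type (max u w) := Quotient (termSetoid.{u, v, w} L E α)

noncomputable instance freeStructure [L.IsAlgebraic] (α : Type w) :
    L.Structure (FreeTerms L E α) where
  funMap f x := ⟦FirstOrder.Language.Term.func f fun i => (x i).out⟧
  RelMap r _ := isEmptyElim r

/-- The value of a class of terms in an algebra. -/
def evalFree {α : Type w} (A : VarietyAlg.{u, v, max u w} L E) (x : α → A.carrier)
    (q : FreeTerms L E α) : A.carrier :=
  Quotient.lift (s := termSetoid L E α) (fun t => t.realize x) (fun _ _ h => h A x) q

theorem evalFree_out {α : Type w} (A : VarietyAlg.{u, v, max u w} L E) (x : α → A.carrier)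
    (q : FreeTerms L E α) : q.out.realize x = evalFree A x q := by
  conv_rhs => rw [← Quotient.out_eq q]
  rfl

/-- Operations on classes use chosen representatives; the choice is harmless because the value of a
class in any algebra does not depend on it. -/
theorem realize_free [L.IsAlgebraic] {α : Type w} {β : Type*} (t : L.Term β)
    (x : β → FreeTerms L E α) :
    t.realize x = (⟦t.subst fun i => (x i).out⟧ : FreeTerms L E α) := by
  induction t with
  | var i => exact (Quotient.out_eq _).symm
  | func f ts ih =>
    apply Quotient.sound
    intro A y
    simp only [FirstOrder.Language.Term.realize_func, ih]
    congr 1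
    funext i
    exact evalFree_out A y _

variable (L E) in
/-- The free algebra on a type of generators. -/
noncomputable def freeAlg [L.IsAlgebraic] (α : Type w) : VarietyAlg.{u, v, max u w} L E where
  carrier := FreeTerms L E α
  sat p hp x := by
    rw [realize_free, realize_free]
    apply Quotient.sound
    intro A y
    rw [FirstOrder.Language.Term.realize_subst, FirstOrder.Language.Term.realize_subst]
    exact A.sat p hp _

variable (L E) in
/-- The generators of the free algebra. -/
def freeGen [L.IsAlgebraic] {α : Type w} (a : α) : (freeAlg L E α).carrier :=
  (⟦FirstOrder.Language.Term.var a⟧ : FreeTerms L E α)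

/-- The morphism out of the free algebra extending a family of elements. -/
noncomputable def freeLift [L.IsAlgebraic] {α : Type w} (A : VarietyAlg.{u, v, max u w} L E)
    (x : α → A.carrier) : freeAlg L E α ⟶ A :=
  homMk (evalFree A x) fun φ y => by
    change FirstOrder.Language.Structure.funMap φ (fun i => (y i).out.realize x) = _
    congr 1
    funext i
    exact evalFree_out A x _

theorem free_hom_ext [L.IsAlgebraic] {α : Type w} {A : VarietyAlg.{u, v, max u w} L E}
    {f g : freeAlg L E α ⟶ A} (h : ∀ a, app f (freeGen L E a) = app g (freeGen L E a)) :
    f = g := by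
  apply hom_ext_app
  intro q
  induction q using Quotient.inductionOn with
  | h t =>
    have ht : t.realize (fun a => (⟦FirstOrder.Language.Term.var a⟧ : FreeTerms L E α)) = ⟦t⟧ := by
      rw [realize_free]
      apply Quotient.sound
      intro B y
      rw [FirstOrder.Language.Term.realize_subst]
      congr 1
      funext a
      exact evalFree_out B y _
    have hf := app_realize f t (fun a => freeGen L E a)
    have hg := app_realize g t (fun a => freeGen L E a)
    simp only [h] at hf
    exact (congrArg (app f) ht.symm).trans
      ((hf.trans hg.symm).trans (congrArg (app g) ht))

/-- Elements of `A` correspond to morphisms from the free algebra on one generator. -/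
theorem injective_of_mono [L.IsAlgebraic] {A B : VarietyAlg.{u, v, max u w} L E} (f : A ⟶ B)
    [Mono f] : Function.Injective (app f) := by
  intro a b hab
  have h : freeLift A (fun _ : PUnit.{w + 1} => a) = freeLift A fun _ => b := by
    rw [← cancel_mono f]
    exact free_hom_ext fun _ => hab
  exact app_congr h (freeGen L E PUnit.unit)

/-! ### Constants -/

theorem exists_closed_term [L.IsAlgebraic]
    (c : (⊥_ (VarietyAlg.{u, v, max u w} L E)).carrier) :
    ∃ t : L.Term Empty, ∀ (A : VarietyAlg.{u, v, max u w} L E)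
      (f : ⊥_ (VarietyAlg.{u, v, max u w} L E) ⟶ A), app f c = t.realize Empty.elim := by
  obtain ⟨t, ht⟩ := Quotient.exists_rep
    (app (initial.to (initialAlg.{u, v, w} L E)) c : ClosedTerms.{u, v, w} L E)
  refine ⟨t.relabel PEmpty.elim, fun A f => ?_⟩
  have hf : f = initial.to (initialAlg.{u, v, w} L E) ≫ evalHom A := initial.hom_ext _ _
  rw [hf, app_comp, FirstOrder.Language.Term.realize_relabel]
  change evalClosed A (app (initial.to (initialAlg.{u, v, w} L E)) c) = _
  rw [← ht]
  change t.realize PEmpty.elim = _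
  congr 1
  funext i
  exact i.elim

theorem app_of_closed_term {A B : VarietyAlg.{u, v, w} L E} (f : A ⟶ B) (t : L.Term Empty) :
    app f (t.realize Empty.elim) = t.realize Empty.elim := by
  rw [app_realize]
  congr 1
  funext i
  exact i.elim

/-! ### Relations and subproduct reflexive relations -/

/-- Purely formal: a product of monomorphisms followed by the interchange of the two middle factors
is again a monomorphism. -/
theorem productRestricts {C : Type u} [Category.{v} C] [HasBinaryProducts C] [HasInitial C]
    (X Y : C) : ProductRestricts X Y := by
  rintro ⟨⟨P, d₁, m₁, h₁⟩, ⟨Q, d₂, m₂, h₂⟩⟩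
  let σ : (X ⨯ X) ⨯ (Y ⨯ Y) ⟶ (X ⨯ Y) ⨯ (X ⨯ Y) :=
    prod.lift (prod.map prod.fst prod.fst) (prod.map prod.snd prod.snd)
  let τ : (X ⨯ Y) ⨯ (X ⨯ Y) ⟶ (X ⨯ X) ⨯ (Y ⨯ Y) :=
    prod.lift (prod.map prod.fst prod.fst) (prod.map prod.snd prod.snd)
  have hστ : σ ≫ τ = 𝟙 _ := by
    ext <;> simp [σ, τ, prod.lift_fst, prod.lift_snd]
  have : Mono σ := mono_of_mono_fac (h := 𝟙 _) hστ
  let δ : P.right ⨯ Q.right ⟶ (X ⨯ X) ⨯ (Y ⨯ Y) := prod.map d₁ d₂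
  have : Mono δ := @prod.map_mono C _ _ _ _ _ d₁ d₂ m₁ m₂ _ _
  refine ⟨δ ≫ σ, mono_comp δ σ, ?_⟩
  change prod.map P.hom Q.hom ≫ prod.map d₁ d₂ ≫ σ = _
  rw [← Category.assoc, prod.map_map, h₁, h₂]
  ext <;> simp [σ, prod.lift_fst, prod.lift_snd]

/-- An object of `Rel_X` from a monomorphism into `X × X`. -/
noncomputable def relOfMono {C : Type u} [Category.{v} C] [HasBinaryProducts C] [HasInitial C]
    {X R : C} (d : R ⟶ X ⨯ X) [Mono d] : RelCat X :=
  ⟨Under.mk (initial.to R), d, inferInstance, initial.hom_ext _ _⟩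

/-- In the presence of a diagonalising term, any two elements of an algebra under `0 × 0` can be
glued along the two projections of `0 × 0`. -/
theorem HasDiagonalisingTerm.exists_glue [L.IsAlgebraic]
    (h : HasDiagonalisingTerm.{u, v, max u w} L E)
    {W : VarietyAlg.{u, v, max u w} L E}
    (r : (⊥_ (VarietyAlg.{u, v, max u w} L E)) ⨯ (⊥_ (VarietyAlg.{u, v, max u w} L E)) ⟶ W)
    (p q : W.carrier) :
    ∃ m : W.carrier,
      (∀ (A : VarietyAlg.{u, v, max u w} L E) (f : W ⟶ A),
        r ≫ f = prod.fst ≫ initial.to A → app f m = app f p) ∧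
      (∀ (A : VarietyAlg.{u, v, max u w} L E) (f : W ⟶ A),
        r ≫ f = prod.snd ≫ initial.to A → app f m = app f q) := by
  obtain ⟨k, -, t, e, e', ht⟩ := h
  -- The pairs `(eᵢ, eᵢ')` are elements of `0 × 0`: a map inducing the first projection sends these
  -- parameters to `eᵢ`, one inducing the second to `eᵢ'`.
  let c : Fin k → W.carrier := fun i =>
    app r (mkPair ((e i).realize Empty.elim) ((e' i).realize Empty.elim))
  refine ⟨t.realize (Sum.elim ![p, q] c), fun A f hf => ?_, fun A f hf => ?_⟩
  · rw [app_realize]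
    refine Eq.trans ?_ (ht A (app f p) (app f q)).1
    congr 1
    funext i
    rcases i with i | i
    · fin_cases i <;> rfl
    · change app f (app r _) = _
      rw [← app_comp, hf, app_comp, fst_mkPair, app_of_closed_term]
      rfl
  · rw [app_realize]
    refine Eq.trans ?_ (ht A (app f p) (app f q)).2
    congr 1
    funext i
    rcases i with i | i
    · fin_cases i <;> rfl
    · change app f (app r _) = _
      rw [← app_comp, hf, app_comp, snd_mkPair, app_of_closed_term]
      rfl

/-- This is where `1 ≤ k` matters: there is at least one constant. -/
theorem HasDiagonalisingTerm.nonempty (h : HasDiagonalisingTerm.{u, v, w} L E)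
    (A : VarietyAlg.{u, v, w} L E) : Nonempty A.carrier := by
  obtain ⟨k, hk, -, e, -⟩ := h
  exact ⟨(e ⟨0, hk⟩).realize Empty.elim⟩

theorem surjective_fst {A B : VarietyAlg.{u, v, w} L E} [Nonempty B.carrier] :
    Function.Surjective (app (prod.fst : A ⨯ B ⟶ A)) := fun a =>
  ⟨mkPair a (Classical.arbitrary _), fst_mkPair _ _⟩

theorem surjective_snd {A B : VarietyAlg.{u, v, w} L E} [Nonempty A.carrier] :
    Function.Surjective (app (prod.snd : A ⨯ B ⟶ B)) := fun b =>
  ⟨mkPair (Classical.arbitrary _) b, snd_mkPair _ _⟩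

theorem epi_of_surjective {A B : VarietyAlg.{u, v, w} L E} (f : A ⟶ B)
    (hf : Function.Surjective (app f)) : Epi f :=
  ⟨fun g h hgh => hom_ext_app fun b => by
    obtain ⟨a, rfl⟩ := hf b
    exact app_congr hgh a⟩

/-- A morphism constant on the fibres of a surjective morphism factors through it. -/
theorem exists_factor [L.IsAlgebraic] {A B D : VarietyAlg.{u, v, w} L E} (p : A ⟶ B)
    (hp : Function.Surjective (app p)) (f : A ⟶ D)
    (hf : ∀ a a', app p a = app p a' → app f a = app f a') : ∃ g : B ⟶ D, p ≫ g = f := by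
  choose s hs using hp
  -- The section `s` need not be a homomorphism, but it is one up to the kernel of `p`, which `f`
  -- does not see.
  refine ⟨homMk (fun b => app f (s b)) fun φ x => ?_, hom_ext_app fun a => hf _ _ (hs _)⟩
  rw [← app_funMap]
  apply hf
  rw [hs, app_funMap]
  simp [hs]

/-! ### From a diagonalising term to an equivalence -/

section Forward

variable [L.IsAlgebraic] {X Y : VarietyAlg.{u, v, max u w} L E}

theorem HasDiagonalisingTerm.faithful (h : HasDiagonalisingTerm.{u, v, max u w} L E)
    (hr : ProductRestricts X Y) : (restrictedProduct hr).Faithful where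
  map_injective {P Q φ ψ} hφ := by
    have := h.nonempty
    have e₁ : Epi (prod.fst : P.1.obj.right ⨯ P.2.obj.right ⟶ _) :=
      epi_of_surjective _ surjective_fst
    have e₂ : Epi (prod.snd : P.1.obj.right ⨯ P.2.obj.right ⟶ _) :=
      epi_of_surjective _ surjective_snd
    have key : prod.map φ.1.hom.right φ.2.hom.right = prod.map ψ.1.hom.right ψ.2.hom.right :=
      congrArg (fun χ => χ.hom.right) hφ
    refine Prod.ext ?_ ?_
    · apply ObjectProperty.hom_ext
      apply Under.UnderMorphism.ext
      rw [← cancel_epi (prod.fst : P.1.obj.right ⨯ P.2.obj.right ⟶ _),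
        ← prod.map_fst φ.1.hom.right φ.2.hom.right, key, prod.map_fst]
    · apply ObjectProperty.hom_ext
      apply Under.UnderMorphism.ext
      rw [← cancel_epi (prod.snd : P.1.obj.right ⨯ P.2.obj.right ⟶ _),
        ← prod.map_snd φ.1.hom.right φ.2.hom.right, key, prod.map_snd]

theorem HasDiagonalisingTerm.full (h : HasDiagonalisingTerm.{u, v, max u w} L E)
    (hr : ProductRestricts X Y) : (restrictedProduct hr).Full where
  map_surjective {P Q} ψ := by
    have := h.nonempty
    let r := prod.map P.1.obj.hom P.2.obj.hom
    let f : P.1.obj.right ⨯ P.2.obj.right ⟶ Q.1.obj.right ⨯ Q.2.obj.right := ψ.hom.right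
    have hf : r ≫ f = prod.map Q.1.obj.hom Q.2.obj.hom := Under.w ψ.hom
    have h₁ : r ≫ f ≫ prod.fst = prod.fst ≫ initial.to _ := by
      rw [← Category.assoc, hf, prod.map_fst]
      congr 1
      exact initial.hom_ext _ _
    have h₂ : r ≫ f ≫ prod.snd = prod.snd ≫ initial.to _ := by
      rw [← Category.assoc, hf, prod.map_snd]
      congr 1
      exact initial.hom_ext _ _
    have r₁ : r ≫ prod.fst = prod.fst ≫ initial.to _ := by
      rw [prod.map_fst]
      congr 1
      exact initial.hom_ext _ _
    have r₂ : r ≫ prod.snd = prod.snd ≫ initial.to _ := by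
      rw [prod.map_snd]
      congr 1
      exact initial.hom_ext _ _
    obtain ⟨g₁, hg₁⟩ := exists_factor (prod.fst : P.1.obj.right ⨯ P.2.obj.right ⟶ _)
      surjective_fst (f ≫ prod.fst) fun a b hab => by
        -- If `a` and `b` share their first coordinate, gluing them gives `b` itself, yet `f ≫
        -- prod.fst` takes the same value on the glued element as on `a`.
        obtain ⟨m, hm, hm'⟩ := h.exists_glue r a b
        have : m = b := prod_ext_app ((hm _ _ r₁).trans hab) (hm' _ _ r₂)
        rw [← this]
        exact (hm _ _ h₁).symm
    obtain ⟨g₂, hg₂⟩ := exists_factor (prod.snd : P.1.obj.right ⨯ P.2.obj.right ⟶ _)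
      surjective_snd (f ≫ prod.snd) fun a b hab => by
        obtain ⟨m, hm, hm'⟩ := h.exists_glue r a b
        have : m = a := prod_ext_app (hm _ _ r₁) ((hm' _ _ r₂).trans hab.symm)
        rw [← this]
        exact hm' _ _ h₂
    let k₁ : P.1 ⟶ Q.1 := ObjectProperty.homMk (Under.homMk g₁ (initial.hom_ext _ _))
    let k₂ : P.2 ⟶ Q.2 := ObjectProperty.homMk (Under.homMk g₂ (initial.hom_ext _ _))
    refine ⟨Prod.mk k₁ k₂, ?_⟩
    apply ObjectProperty.hom_ext
    apply Under.UnderMorphism.ext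
    change prod.map g₁ g₂ = f
    apply Limits.prod.hom_ext
    · rw [prod.map_fst, hg₁]
    · rw [prod.map_snd, hg₂]

theorem HasDiagonalisingTerm.essSurj (h : HasDiagonalisingTerm.{u, v, max u w} L E)
    (hr : ProductRestricts X Y) : (restrictedProduct hr).EssSurj where
  mem_essImage S := by
    obtain ⟨R, d, _, hd⟩ := S
    let f₁ : R.right ⟶ X ⨯ X := d ≫ prod.map prod.fst prod.fst
    let f₂ : R.right ⟶ Y ⨯ Y := d ≫ prod.map prod.snd prod.snd
    let g₁ : R.right ⟶ subAlg (FirstOrder.Language.Hom.range f₁) :=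
      subLift _ f₁ fun b => ⟨b, rfl⟩
    let g₂ : R.right ⟶ subAlg (FirstOrder.Language.Hom.range f₂) :=
      subLift _ f₂ fun b => ⟨b, rfl⟩
    have s₁ : Function.Surjective (app g₁) := by
      rintro ⟨_, b, rfl⟩
      exact ⟨b, rfl⟩
    have s₂ : Function.Surjective (app g₂) := by
      rintro ⟨_, b, rfl⟩
      exact ⟨b, rfl⟩
    have v₁ : g₁ ≫ subIncl _ = f₁ := rfl
    -- Reflexivity along `0 × 0` makes the map to the first image induce the first projection, as
    -- gluing requires.
    have w₁ : R.hom ≫ g₁ = prod.fst ≫ initial.to _ := by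
      rw [← cancel_mono (subIncl _), Category.assoc, v₁, ← Category.assoc, hd,
        Category.assoc, Category.assoc, initial.to_comp]
      ext <;> simp [prod.lift_fst, prod.lift_snd]
    have v₂ : g₂ ≫ subIncl _ = f₂ := rfl
    have w₂ : R.hom ≫ g₂ = prod.snd ≫ initial.to _ := by
      rw [← cancel_mono (subIncl _), Category.assoc, v₂, ← Category.assoc, hd,
        Category.assoc, Category.assoc, initial.to_comp]
      ext <;> simp [prod.lift_fst, prod.lift_snd]
    let θ : R.right ⟶ subAlg (FirstOrder.Language.Hom.range f₁) ⨯
        subAlg (FirstOrder.Language.Hom.range f₂) := prod.lift g₁ g₂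
    have hθ : Function.Bijective (app θ) := by
      refine ⟨fun a b hab => injective_of_mono d ?_, fun p => ?_⟩
      · have i₁ : app f₁ a = app f₁ b := by
          have := congrArg (fun z => app (subIncl _) (app prod.fst z)) hab
          simp only [θ, app_lift_fst] at this
          exact this
        have i₂ : app f₂ a = app f₂ b := by
          have := congrArg (fun z => app (subIncl _) (app prod.snd z)) hab
          simp only [θ, app_lift_snd] at this
          exact this
        simp only [f₁, f₂, app_comp] at i₁ i₂
        have j₁ := congrArg (app prod.fst) i₁
        have j₂ := congrArg (app prod.snd) i₁
        have j₃ := congrArg (app prod.fst) i₂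
        have j₄ := congrArg (app prod.snd) i₂
        simp only [app_prodMap_fst, app_prodMap_snd] at j₁ j₂ j₃ j₄
        exact prod_ext_app (prod_ext_app j₁ j₃) (prod_ext_app j₂ j₄)
      · obtain ⟨a, ha⟩ := s₁ (app prod.fst p)
        obtain ⟨b, hb⟩ := s₂ (app prod.snd p)
        -- Surjectivity onto the product of the images is exactly gluing; injectivity above needed
        -- only that `d` is a monomorphism.
        obtain ⟨m, hm, hm'⟩ := h.exists_glue R.hom a b
        refine ⟨m, prod_ext_app ?_ ?_⟩
        · rw [app_lift_fst, hm _ _ w₁, ha]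
        · rw [app_lift_snd, hm' _ _ w₂, hb]
    have hiso : IsIso θ := isIso_of_bijective θ hθ
    let ι : R.right ≅ _ := @asIso _ _ _ _ θ hiso
    have hw : R.hom ≫ θ = prod.map (initial.to _) (initial.to _) := by
      apply Limits.prod.hom_ext
      · rw [Category.assoc, prod.lift_fst, w₁, prod.map_fst]
      · rw [Category.assoc, prod.lift_snd, w₂, prod.map_snd]
    refine ⟨(relOfMono (subIncl (FirstOrder.Language.Hom.range f₁)),
      relOfMono (subIncl (FirstOrder.Language.Hom.range f₂))),
      ⟨(ObjectProperty.isoMk _ (Under.isoMk ι hw)).symm⟩⟩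

end Forward

/-! ### From an equivalence to a diagonalising term: fullness and constants -/

/-- If the product functor is full, then a morphism of products under `0 × 0` is a product of
morphisms. -/
theorem exists_eq_prodMap {C : Type u} [Category.{v} C] [HasBinaryProducts C] [HasInitial C]
    {X Y : C} (hr : ProductRestricts X Y) [(restrictedProduct hr).Full]
    (P Q : RelCat X × RelCat Y)
    (f : P.1.obj.right ⨯ P.2.obj.right ⟶ Q.1.obj.right ⨯ Q.2.obj.right)
    (hf : prod.map P.1.obj.hom P.2.obj.hom ≫ f = prod.map Q.1.obj.hom Q.2.obj.hom) :
    ∃ (g₁ : P.1.obj.right ⟶ Q.1.obj.right) (g₂ : P.2.obj.right ⟶ Q.2.obj.right),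
      prod.map g₁ g₂ = f := by
  let ψ : (restrictedProduct hr).obj P ⟶ (restrictedProduct hr).obj Q :=
    ObjectProperty.homMk (Under.homMk f hf)
  obtain ⟨φ, hφ⟩ := (restrictedProduct hr).map_surjective ψ
  exact ⟨φ.1.hom.right, φ.2.hom.right, congrArg (fun χ => χ.hom.right) hφ⟩

/-- If `0` were empty, any product with `0` would be empty and would map to anything. Fullness would
then split such a map and produce a morphism from a nonempty free algebra to an empty one. -/
theorem nonempty_initial_of_full [L.IsAlgebraic]
    (H : ∀ X Y : VarietyAlg.{u, v, max u w} L E,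
      ∃ h : ProductRestricts X Y, (restrictedProduct h).Full) :
    Nonempty (⊥_ (VarietyAlg.{u, v, max u w} L E)).carrier := by
  by_contra hne
  rw [not_nonempty_iff] at hne
  let F : VarietyAlg.{u, v, max u w} L E := freeAlg L E PUnit.{w + 1}
  obtain ⟨hr, _⟩ := H (⊥_ _) F
  let Z : RelCat (⊥_ (VarietyAlg.{u, v, max u w} L E)) := relOfMono (diag _)
  let P : RelCat F := relOfMono (diag F)
  have hm : Mono (initial.to F) := mono_of_injective _ (Function.injective_of_subsingleton _)
  -- The empty relation on `F`, carried by `0`.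
  let Q : RelCat F := @relOfMono _ _ _ _ _ _ (initial.to F ≫ diag F) (mono_comp _ _)
  have hZ : IsEmpty Z.obj.right.carrier := hne
  have hZP : IsEmpty (Z.obj.right ⨯ P.obj.right).carrier :=
    Function.isEmpty (app (prod.fst : Z.obj.right ⨯ P.obj.right ⟶ _))
  have h₀ : IsEmpty
      ((⊥_ (VarietyAlg.{u, v, max u w} L E)) ⨯ (⊥_ (VarietyAlg.{u, v, max u w} L E))).carrier :=
    Function.isEmpty (app prod.fst)
  obtain ⟨-, g, -⟩ := exists_eq_prodMap hr (Z, P) (Z, Q)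
    (homMk (fun z => hZP.elim z) fun {_} φ x =>
      hZP.elim (FirstOrder.Language.Structure.funMap φ x)) (hom_ext_app fun z => h₀.elim z)
  exact hne.elim (app g (freeGen L E PUnit.unit))

/-- Every term uses only finitely many of its parameters. -/
theorem exists_term_fin {α β : Type*} (b : β) (t : L.Term (α ⊕ β)) :
    ∃ (k : ℕ) (_ : 1 ≤ k) (s : L.Term (α ⊕ Fin k)) (c : Fin k → β),
      s.relabel (Sum.map id c) = t := by
  classical
  -- Inserting `b` ensures `1 ≤ k` even when `t` has no parameters; it also supplies the default
  -- value of `g`, never reached on parameters of `t`.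
  let S : Finset β := insert b (t.varFinset.biUnion fun i => i.elim (fun _ => ∅) fun j => {j})
  have hS : ∀ j, Sum.inr j ∈ t.varFinset → j ∈ S := fun j hj =>
    Finset.mem_insert_of_mem (Finset.mem_biUnion.2 ⟨_, hj, Finset.mem_singleton_self j⟩)
  let g : β → Fin S.card := fun j =>
    if hj : j ∈ S then S.equivFin ⟨j, hj⟩ else S.equivFin ⟨b, Finset.mem_insert_self _ _⟩
  let c : Fin S.card → β := fun i => (S.equivFin.symm i : β)
  have hc : ∀ j ∈ S, c (g j) = j := fun j hj => by simp [c, g, hj]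
  refine ⟨S.card, Finset.card_pos.2 ⟨b, Finset.mem_insert_self _ _⟩,
    t.relabel (Sum.map id g), c, ?_⟩
  rw [FirstOrder.Language.Term.relabel_relabel]
  -- Stated for all terms with variables among those of `t`, so that the induction passes to
  -- subterms.
  have key : ∀ r : L.Term (α ⊕ β), r.varFinset ⊆ t.varFinset →
      r.relabel (Sum.map id c ∘ Sum.map id g) = r := by
    intro r
    induction r with
    | var i =>
      intro hi
      rcases i with i | j
      · rfl
      · have := hc j (hS j (hi (by simp)))
        simp [this]
    | func f ts ih =>
      intro hf
      simp only [FirstOrder.Language.Term.relabel]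
      congr 1
      funext i
      exact ih i fun x hx => hf (by
        simp only [FirstOrder.Language.Term.varFinset, Finset.mem_biUnion, Finset.mem_univ,
          true_and]
        exact ⟨i, hx⟩)
  exact key t subset_rfl

/-! ### Extracting the term from the free algebra on two generators -/

section Backward

variable (L E) in
/-- The set of pairs `(x, x)`, `(y, y)` for the free generators `x`, `y`, together with the image
of `0 × 0`, in the square of the free algebra on two generators. -/
def gluingSet [L.IsAlgebraic] :
    Set (freeAlg.{u, v, w} L E (ULift (Fin 2)) ⨯ freeAlg L E (ULift (Fin 2))).carrier :=
  {z | (∃ i : ULift (Fin 2), z = mkPair (freeGen L E i) (freeGen L E i)) ∨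
    ∃ c, z = app (prod.map (initial.to (freeAlg.{u, v, w} L E (ULift (Fin 2))))
      (initial.to (freeAlg L E (ULift (Fin 2))))) c}

/-- If the pair `(x, y)` lies in the subalgebra generated by `(x, x)`, `(y, y)` and `0 × 0`, then
there is a diagonalising term. -/
theorem hasDiagonalisingTerm_of_mem_closure [L.IsAlgebraic]
    (hne : Nonempty (⊥_ (VarietyAlg.{u, v, max u w} L E)).carrier)
    (h : (mkPair (freeGen L E ⟨0⟩) (freeGen L E ⟨1⟩) :
        (freeAlg.{u, v, w} L E (ULift (Fin 2)) ⨯ freeAlg L E (ULift (Fin 2))).carrier) ∈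
      FirstOrder.Language.Substructure.closure L (gluingSet.{u, v, w} L E)) :
    HasDiagonalisingTerm.{u, v, max u w} L E := by
  obtain ⟨t, ht⟩ := FirstOrder.Language.Substructure.mem_closure_iff_exists_term.1 h
  let F : VarietyAlg.{u, v, max u w} L E := freeAlg L E (ULift (Fin 2))
  obtain ⟨c₀⟩ := hne
  obtain ⟨e₀, -⟩ := exists_closed_term c₀
  -- Each generator is a variable in both coordinates or a pair of closed terms; `j` records which,
  -- turning `t` into a term in two variables with pairs of closed terms as parameters.
  have hs : ∀ z : gluingSet.{u, v, w} L E, ∃ j : Fin 2 ⊕ (L.Term Empty × L.Term Empty),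
      app (prod.fst : F ⨯ F ⟶ F) z.1 =
        j.elim (fun i => freeGen L E ⟨i⟩) (fun p => p.1.realize Empty.elim) ∧
      app (prod.snd : F ⨯ F ⟶ F) z.1 =
        j.elim (fun i => freeGen L E ⟨i⟩) (fun p => p.2.realize Empty.elim) := by
    rintro ⟨z, ⟨i, rfl⟩ | ⟨c, rfl⟩⟩
    · exact ⟨Sum.inl i.down, fst_mkPair _ _, snd_mkPair _ _⟩
    · obtain ⟨e, he⟩ := exists_closed_term (app prod.fst c)
      obtain ⟨e', he'⟩ := exists_closed_term (app prod.snd c)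
      refine ⟨Sum.inr (e, e'), ?_, ?_⟩
      · exact (app_prodMap_fst _ _ _).trans (he _ _)
      · exact (app_prodMap_snd _ _ _).trans (he' _ _)
  choose j hj₁ hj₂ using hs
  obtain ⟨k, hk, s, c, hsc⟩ := exists_term_fin (e₀, e₀) (t.relabel j)
  have h₁ := congrArg (app (prod.fst : F ⨯ F ⟶ F)) ht
  have h₂ := congrArg (app (prod.snd : F ⨯ F ⟶ F)) ht
  rw [app_realize, fst_mkPair] at h₁
  rw [app_realize, snd_mkPair] at h₂
  refine ⟨k, hk, s, fun i => (c i).1, fun i => (c i).2, fun A x y => ?_⟩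
  let φ : F ⟶ A := freeLift A fun i => ![x, y] i.down
  have hφ₁ : app φ (freeGen L E ⟨0⟩) = x := rfl
  have hφ₂ : app φ (freeGen L E ⟨1⟩) = y := rfl
  -- Taking `d` to be `Prod.fst` or `Prod.snd` treats both identities at once.
  have key : ∀ d : L.Term Empty × L.Term Empty → L.Term Empty,
      s.realize (Sum.elim ![x, y] fun i => (d (c i)).realize (Empty.elim : Empty → A.carrier)) =
      app φ (t.realize fun z => (j z).elim (fun i => freeGen L E ⟨i⟩)
        fun p => (d p).realize Empty.elim) := by
    intro d
    have e₁ : (fun z => (j z).elim (fun i => (freeGen L E ⟨i⟩ : F.carrier))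
        fun p => (d p).realize Empty.elim) =
      (Sum.elim (fun i => (freeGen L E ⟨i⟩ : F.carrier))
        fun p => (d p).realize Empty.elim) ∘ j := rfl
    rw [e₁, ← FirstOrder.Language.Term.realize_relabel, ← hsc,
      FirstOrder.Language.Term.realize_relabel, app_realize]
    congr 1
    funext i
    rcases i with i | i
    · rfl
    · exact (app_of_closed_term φ _).symm
  refine ⟨(key Prod.fst).trans ?_, (key Prod.snd).trans ?_⟩
  · rw [← hφ₁, ← h₁]
    congr 2
    funext z
    exact (hj₁ z).symm
  · rw [← hφ₂, ← h₂]
    congr 2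
    funext z
    exact (hj₂ z).symm

theorem pair_mem_closure_of_isEquivalence [L.IsAlgebraic]
    (hr : ProductRestricts (freeAlg.{u, v, w} L E (ULift (Fin 2)))
      (freeAlg.{u, v, w} L E (ULift (Fin 2))))
    [(restrictedProduct hr).Full] [(restrictedProduct hr).EssSurj] :
    (mkPair (freeGen L E ⟨0⟩) (freeGen L E ⟨1⟩) :
        (freeAlg.{u, v, w} L E (ULift (Fin 2)) ⨯ freeAlg L E (ULift (Fin 2))).carrier) ∈
      FirstOrder.Language.Substructure.closure L (gluingSet.{u, v, w} L E) := by
  let F : VarietyAlg.{u, v, max u w} L E := freeAlg L E (ULift (Fin 2))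
  let S : L.Substructure (F ⨯ F).carrier :=
    FirstOrder.Language.Substructure.closure L (gluingSet.{u, v, w} L E)
  let ι : (⊥_ _) ⨯ (⊥_ _) ⟶ F ⨯ F := prod.map (initial.to F) (initial.to F)
  let r : (⊥_ _) ⨯ (⊥_ _) ⟶ subAlg S := subLift S ι fun c =>
    FirstOrder.Language.Substructure.subset_closure (Or.inr ⟨c, rfl⟩)
  have hrι : r ≫ subIncl S = ι := rfl
  -- The subalgebra `S` of `F × F` seen as a relation contained in the diagonal.
  let R : SPRRelCat F F := ⟨Under.mk r, subIncl S ≫ diag (F ⨯ F), mono_comp _ _, by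
    change r ≫ subIncl S ≫ diag _ = _
    rw [← Category.assoc, hrι]⟩
  obtain ⟨P, ⟨e⟩⟩ := Functor.EssSurj.mem_essImage (F := restrictedProduct hr) R
  -- The diagonal relations are carried by `F`, so the inclusion of `S` becomes a map between
  -- products, to which fullness applies.
  let Q : RelCat F × RelCat F := (relOfMono (diag F), relOfMono (diag F))
  let a : P.1.obj.right ⨯ P.2.obj.right ⟶ subAlg S := e.hom.hom.right
  let b : subAlg S ⟶ P.1.obj.right ⨯ P.2.obj.right := e.inv.hom.right
  have hba : b ≫ a = 𝟙 _ := congrArg (fun χ => χ.hom.right) e.inv_hom_id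
  have ha : prod.map P.1.obj.hom P.2.obj.hom ≫ a = r := Under.w e.hom.hom
  have hw : prod.map P.1.obj.hom P.2.obj.hom ≫ a ≫ subIncl S = ι := by
    rw [← Category.assoc, ha, hrι]
  obtain ⟨g₁, g₂, hg⟩ : ∃ (g₁ : P.1.obj.right ⟶ F) (g₂ : P.2.obj.right ⟶ F),
      prod.map g₁ g₂ = a ≫ subIncl S := exists_eq_prodMap hr P Q (a ≫ subIncl S) hw
  have hmem : ∀ i : ULift (Fin 2), ∃ p : (P.1.obj.right ⨯ P.2.obj.right).carrier,
      app g₁ (app prod.fst p) = freeGen L E i ∧ app g₂ (app prod.snd p) = freeGen L E i := by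
    intro i
    let z : (subAlg S).carrier := ⟨mkPair (freeGen L E i) (freeGen L E i),
      FirstOrder.Language.Substructure.subset_closure (Or.inl ⟨i, rfl⟩)⟩
    have hz : app (prod.map g₁ g₂) (app b z) = mkPair (freeGen L E i) (freeGen L E i) := by
      rw [hg, app_comp, ← app_comp b a, hba]
      rfl
    refine ⟨app b z, ?_, ?_⟩
    · rw [← app_prodMap_fst g₁ g₂, hz]
      exact fst_mkPair _ _
    · rw [← app_prodMap_snd g₁ g₂, hz]
      exact snd_mkPair _ _
  obtain ⟨p, hp, -⟩ := hmem ⟨0⟩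
  obtain ⟨q, -, hq⟩ := hmem ⟨1⟩
  -- The image of a product map is a rectangle: combining the first coordinate of a preimage of `(x,
  -- x)` with the second of a preimage of `(y, y)` reaches `(x, y)`.
  have hm : app (prod.map g₁ g₂) (mkPair (app prod.fst p) (app prod.snd q)) =
      mkPair (freeGen L E ⟨0⟩) (freeGen L E ⟨1⟩) := by
    apply prod_ext_app
    · rw [app_prodMap_fst, fst_mkPair, hp]
      exact (fst_mkPair _ _).symm
    · rw [app_prodMap_snd, snd_mkPair, hq]
      exact (snd_mkPair _ _).symm
  rw [hg, app_comp] at hm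
  rw [← hm]
  exact (app a (mkPair (app prod.fst p) (app prod.snd q))).2

end Backward

end VarietyAlg

theorem proposition3p9 (L : FirstOrder.Language.{u, v}) [L.IsAlgebraic] (E : Set (L.Term ℕ × L.Term ℕ)) :
    VarietyAlg.HasDiagonalisingTerm.{u, v, max u w} L E ↔
      ∀ X Y : VarietyAlg.{u, v, max u w} L E,
        ∃ h : ProductRestricts X Y, (restrictedProduct h).IsEquivalence := by
  constructor
  · intro h X Y
    have hr := VarietyAlg.productRestricts X Y
    exact ⟨hr, { faithful := h.faithful hr, full := h.full hr, essSurj := h.essSurj hr }⟩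
  · intro H
    obtain ⟨hr, hE⟩ := H (VarietyAlg.freeAlg L E (ULift.{w} (Fin 2)))
      (VarietyAlg.freeAlg L E (ULift.{w} (Fin 2)))
    refine VarietyAlg.hasDiagonalisingTerm_of_mem_closure
      (VarietyAlg.nonempty_initial_of_full fun X Y => ?_)
      (VarietyAlg.pair_mem_closure_of_isEquivalence hr)
    obtain ⟨h, hE'⟩ := H X Y
    exact ⟨h, inferInstance⟩
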